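/- **Setting.** A compact convex rigid body $K\subset\mathbb R^3$ with smooth strongly convex boundary, described in a body frame with origin at its center of mass, is invariant under rotations about the axis $e_3$. It has mass $m>0$, inertia tensor $\mathbb I=\mathrm{diag}(\mathbb I_1,\mathbb I_1,\mathbb I_3)$ with $\mathbb I_1,\mathbb I_3>0$, and it rolls without slipping on a horizontal plane under constant vertical gravity of strength $\mathrm g$. For $\gamma\in S^2$ let $s(\gamma)=(\varrho(\gamma_3)\gamma_1,\varrho(\gamma_3)\gamma_2,\zeta(\gamma_3))$ be the point of $\partial K$ with inward unit normal $\gamma$ (the inverse of the Gauss map), where $\varrho,\zeta$ are smooth on $[-1,1]$. For $g\in SO(3)$ let $\gamma$ be its third row and write $\varrho=\varrho(\gamma_3)$, $s=s(\gamma)$. The configuration space is $Q=\{(g,a)\in SO(3)\times\mathbb R^3 : a_3=-\langle\gamma,s\rangle\}$. Let $\lambda=(\lambda_1,\lambda_2,\lambda_3)$ be the left-invariant Maurer–Cartan forms of $SO(3)$, so that $\lambda$ takes the value $\Omega$ (the angular velocity in body coordinates) on a velocity $(\dot g,\dot a)$. The lagrangian is $L=\frac12\langle\mathbb I\Omega,\Omega\rangle+\frac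 m2\langle\dot a,\dot a\rangle-m\mathrm g\,a_3$ with kinetic energy metric $\kappa$, and the constraint distribution $D\subset TQ$ is given by $\dot a=-g(\Omega\times s)$. Put $\mathcal M=\kappa^\flat(D)\subset T^*Q$ with projection $\tau:\mathcal M\to Q$; regard $\Omega$ as a function on $\mathcal M$ through $\kappa^\flat:D\to\mathcal M$, and $\lambda_i$ as 1-forms on $\mathcal M$ by pull-back. Let $\mathcal C=\{v\in T\mathcal M : T\tau(v)\in D\}$, let $\Omega_{\mathcal M}$ be the pull-back to $\mathcal M$ of the canonical 2-form $\Omega_Q=-d\Theta_Q$ of $T^*Q$ ($\Theta_Q$ the Liouville 1-form), and let $\mathcal H_{\mathcal M}$ be the restriction to $\mathcal M$ of the hamiltonian of $L$. The nonholonomic vector field $X_{nh}$ is the section of $\mathcal C$ with $i_{X_{nh}}\Omega_{\mathcal M}|_{\mathcal C}=d\mathcal H_{\mathcal M}|_{\mathcal C}$. **Proposition.** $\mathcal H_{\mathcal M}$ is smooth and $X_{nh}$ is well defined (such a vector exists and is unique at each point of $\mathcal M$). The 2-form $$B=m\,\varrho\,\langle\gamma,s\rangle\,\langle\Omega,d\lambda\rangle=m\,\varrho\,\langle\gamma,s\rangle\sum_{i=1}^3\Omega_i\,d\lambda_i$$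 on $\mathcal M$ is smooth and defines a dynamical gauge transformation of the nonholonomic system, that is, (i) $(\Omega_{\mathcal M}+B)|_{\mathcal C}$ is nondegenerate at each point of $\mathcal M$; (ii) $i_{X_{nh}}B=0$ on $T\mathcal M$. Hence, for every point of $\mathcal M$ and every covector $\alpha$ there, the relation $\pi_B^\sharp(\alpha)=-X$ if and only if $X\in\mathcal C$ and $i_X(\Omega_{\mathcal M}+B)|_{\mathcal C}=\alpha|_{\mathcal C}$ defines $\pi_B^\sharp(\alpha)$ uniquely, and $\pi_B$ describes the nonholonomic dynamics: $X_{nh}=-\pi_B^\sharp(d\mathcal H_{\mathcal M})$. -/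

import Mathlib

open scoped Matrix Topology ContDiff

noncomputable section

/-! ### Generalities on submanifolds, given as subsets of a normed space -/

/-- The tangent space at `x` of a submanifold `N` of a normed space: the velocities at time `0` of
smooth curves that lie in `N` and pass through `x` at time `0`. -/
def tangentVectors {V : Type*} [NormedAddCommGroup V] [NormedSpace ℝ V] (N : Set V) (x : V) :
    Set V :=
  {v | ∃ c : ℝ → V, ContDiffAt ℝ ∞ c 0 ∧ c 0 = x ∧ (∀ᶠ t in 𝓝 0, c t ∈ N) ∧ HasDerivAt c v 0}

/-- The bilinear form `σ` restricted to `W` is nondegenerate. -/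
def NondegenerateOn {V : Type*} [NormedAddCommGroup V] [NormedSpace ℝ V] (W : Set V)
    (σ : V [⋀^Fin 2]→L[ℝ] ℝ) : Prop :=
  ∀ u ∈ W, (∀ v ∈ W, σ ![u, v] = 0) → u = 0

/-- `X` is a vector of `W` with `i_X σ |_W = α |_W`. -/
def Represents {V : Type*} [NormedAddCommGroup V] [NormedSpace ℝ V] (W : Set V)
    (σ : V [⋀^Fin 2]→L[ℝ] ℝ) (α : V →L[ℝ] ℝ) (X : V) : Prop :=
  X ∈ W ∧ ∀ v ∈ W, σ ![X, v] = α v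

/-- A field of linear functionals, regarded as a differential 1-form. -/
def oneForm {V : Type*} [NormedAddCommGroup V] [NormedSpace ℝ V] (θ : V → (V →L[ℝ] ℝ)) :
    V → V [⋀^Fin 1]→L[ℝ] ℝ :=
  fun x => ContinuousAlternatingMap.ofSubsingleton ℝ V ℝ 0 (θ x)

/-! ### Convex bodies in Euclidean 3-space -/

/-- Vectors of `ℝ³`; the inner product is `⬝ᵥ` and the vector product is `⨯₃`. -/
abbrev Vec3 := Fin 3 → ℝ

/-- Real `3 × 3` matrices. -/
abbrev Mat3 := Matrix (Fin 3) (Fin 3) ℝ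

/-- The rotation of angle `θ` about the axis `e₃`. -/
def rotE3 (θ : ℝ) : Mat3 :=
  !![Real.cos θ, -Real.sin θ, 0; Real.sin θ, Real.cos θ, 0; 0, 0, 1]

/-- `K` is a compact convex body with smooth, strongly convex boundary: near each boundary
point, `K` is a sublevel set `{F ≤ 0}` of a smooth function `F` with `dF ≠ 0` whose Hessian is
positive definite on the tangent plane `ker dF`. -/
structure IsStronglyConvexBody (K : Set Vec3) : Prop where
  isCompact : IsCompact K
  convex : Convex ℝ K
  nonempty_interior : (interior K).Nonempty
  boundary : ∀ x ∈ frontier K, ∃ F : Vec3 → ℝ, ContDiffAt ℝ ∞ F x ∧ F x = 0 ∧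
    (∀ᶠ y in 𝓝 x, y ∈ K ↔ F y ≤ 0) ∧ fderiv ℝ F x ≠ 0 ∧
    ∀ v : Vec3, v ≠ 0 → fderiv ℝ F x v = 0 → 0 < fderiv ℝ (fderiv ℝ F) x v v

/-- `ν` is the inward unit normal at the boundary point `x` of the convex body `K`. -/
def IsInwardUnitNormal (K : Set Vec3) (x ν : Vec3) : Prop :=
  x ∈ frontier K ∧ ν ⬝ᵥ ν = 1 ∧ ∀ y ∈ K, 0 ≤ ν ⬝ᵥ (y - x)

/-- A strongly convex rigid body of revolution with axis `e₃`, described in a body frame whose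
origin is the center of mass, together with the strength of gravity. The functions `ρ` and `ζ`
describe the inverse of the Gauss map of its boundary:
`γ ↦ (ρ(γ₃) γ₁, ρ(γ₃) γ₂, ζ(γ₃))` for unit vectors `γ`. -/
structure BodyOfRevolution where
  /-- the region occupied by the body -/
  K : Set Vec3
  /-- the mass -/
  m : ℝ
  /-- the two equal principal moments of inertia -/
  I₁ : ℝ
  /-- the principal moment of inertia of the symmetry axis -/
  I₃ : ℝ
  /-- the strength of gravity -/
  grav : ℝ
  /-- first shape function -/
  ρ : ℝ → ℝ
  /-- second shape function -/
  ζ : ℝ → ℝ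
  m_pos : 0 < m
  I₁_pos : 0 < I₁
  I₃_pos : 0 < I₃
  isStronglyConvexBody : IsStronglyConvexBody K
  rotation_invariant : ∀ θ : ℝ, ∀ x ∈ K, rotE3 θ *ᵥ x ∈ K
  ρ_smooth : ContDiffOn ℝ ∞ ρ (Set.Icc (-1) 1)
  ζ_smooth : ContDiffOn ℝ ∞ ζ (Set.Icc (-1) 1)
  gauss : ∀ γ : Vec3, γ ⬝ᵥ γ = 1 →
    IsInwardUnitNormal K ![ρ (γ 2) * γ 0, ρ (γ 2) * γ 1, ζ (γ 2)] γ

/-! ### The configuration space -/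

/-- The vector space containing `SO(3) × ℝ³`; a point is `q = (g, a)`, where the `3 × 3` matrix
`g` is given by its rows `g 0 = α`, `g 1 = β`, `g 2 = γ`. -/
abbrev ConfAmb := (Fin 3 → Vec3) × Vec3

/-- The vector `ω` with `A = [ω]_×` when `A` is skew-symmetric. -/
def vee (A : Mat3) : Vec3 := ![A 2 1, A 0 2, A 1 0]

/-- The left-invariant Maurer-Cartan form `λᵢ`, the `i`-th component of the body angular velocity
`vee (gᵀ ġ)` of the velocity `(ġ, ȧ)` at `(g, a)`. -/
def maurerCartan (i : Fin 3) (q : ConfAmb) : ConfAmb →L[ℝ] ℝ :=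
  LinearMap.toContinuousLinearMap
    { toFun := fun w => vee ((Matrix.of q.1)ᵀ * Matrix.of w.1) i
      map_add' := by
        intro u w
        fin_cases i <;> simp [vee, Matrix.mul_apply, Fin.sum_univ_three] <;> ring
      map_smul' := by
        intro r w
        fin_cases i <;> simp [vee, Matrix.mul_apply, Fin.sum_univ_three] <;> ring }

/-- The body angular velocity of the velocity `w = (ġ, ȧ)` at `q = (g, a)`. -/
def angVel (q w : ConfAmb) : Vec3 := fun i => maurerCartan i q w

/-- The 1-form `da_j` on the configuration space (`j = 1, 2`). -/
def daForm (j : Fin 2) : ConfAmb →L[ℝ] ℝ :=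
  (ContinuousLinearMap.proj (R := ℝ) (φ := fun _ : Fin 3 => ℝ) j.castSucc).comp
    (ContinuousLinearMap.snd ℝ (Fin 3 → Vec3) Vec3)

/-! ### The cotangent bundle

The 1-forms `λ₁, λ₂, λ₃, da₁, da₂` are a global frame of `T*Q`. A covector at `q` is given by its
components `(M, p) ∈ ℝ³ × ℝ²` in this frame, so that `T*Q = Q × (ℝ³ × ℝ²)`. -/

/-- The vector space containing `T*Q`; a point is `x = (q, (M, p))`. -/
abbrev PhaseAmb := ConfAmb × (Vec3 × (Fin 2 → ℝ))

/-- The covector `⟨M, λ⟩ + p₁ da₁ + p₂ da₂` at `q` represented by the point `x = (q, (M, p))`. -/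
def covector (x : PhaseAmb) : ConfAmb →L[ℝ] ℝ :=
  ∑ i, x.2.1 i • maurerCartan i x.1 + ∑ j, x.2.2 j • daForm j

/-- The Liouville 1-form `Θ_Q`: a tangent vector is projected to the configuration space, and
the covector is applied to it. -/
def liouville (x : PhaseAmb) : PhaseAmb →L[ℝ] ℝ :=
  (covector x).comp (ContinuousLinearMap.fst ℝ ConfAmb (Vec3 × (Fin 2 → ℝ)))

/-- The canonical 2-form `Ω_Q = - dΘ_Q`. -/
def canonicalForm (x : PhaseAmb) : PhaseAmb [⋀^Fin 2]→L[ℝ] ℝ :=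
  -extDeriv (oneForm liouville) x

/-- The 2-form `dλᵢ` on phase space, where `λᵢ` is pulled back from the configuration space. -/
def dMaurerCartan (i : Fin 3) (x : PhaseAmb) : PhaseAmb [⋀^Fin 2]→L[ℝ] ℝ :=
  extDeriv (oneForm fun y : PhaseAmb =>
    (maurerCartan i y.1).comp (ContinuousLinearMap.fst ℝ ConfAmb (Vec3 × (Fin 2 → ℝ)))) x

namespace BodyOfRevolution

variable (b : BodyOfRevolution)

/-- The inverse Gauss map `s(γ)`. -/
def s (γ : Vec3) : Vec3 := ![b.ρ (γ 2) * γ 0, b.ρ (γ 2) * γ 1, b.ζ (γ 2)]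

/-- The inertia tensor `diag(I₁, I₁, I₃)`. -/
def inertia : Mat3 := Matrix.diagonal ![b.I₁, b.I₁, b.I₃]

/-- The configuration space: `g ∈ SO(3)` and `a₃ = - ⟨γ, s(γ)⟩`, where `γ` is the third row
of `g`. -/
def Q : Set ConfAmb :=
  {q | Matrix.of q.1 ∈ Matrix.specialOrthogonalGroup (Fin 3) ℝ ∧ q.2 2 = -(q.1 2 ⬝ᵥ b.s (q.1 2))}

/-- The constraint distribution: the velocities tangent to `Q` with `ȧ = - g (Ω × s)`. -/
def D (q : ConfAmb) : Set ConfAmb :=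
  {w | w ∈ tangentVectors b.Q q ∧ w.2 = -(Matrix.of q.1 *ᵥ (angVel q w ⨯₃ b.s (q.1 2)))}

/-- The kinetic energy metric `⟨𝕀 Ω, Ω'⟩ + m ⟨ȧ, ȧ'⟩`. -/
def kineticMetric (q v w : ConfAmb) : ℝ :=
  (b.inertia *ᵥ angVel q v) ⬝ᵥ angVel q w + b.m * (v.2 ⬝ᵥ w.2)

/-- The lagrangian: kinetic energy minus gravitational potential energy. -/
def lagrangian (q v : ConfAmb) : ℝ :=
  1 / 2 * b.kineticMetric q v v - b.m * b.grav * q.2 2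

/-- The constraint submanifold `𝓜 = κ♭(D) ⊆ T*Q`. -/
def constraintManifold : Set PhaseAmb :=
  {x | x.1 ∈ b.Q ∧ ∃ v ∈ b.D x.1, ∀ w ∈ tangentVectors b.Q x.1,
    covector x w = b.kineticMetric x.1 v w}

/-- The velocity `v ∈ T_q Q` that corresponds to a covector under the Legendre transformation,
`κ♭(v) = covector x`. -/
def velocity (x : PhaseAmb) : ConfAmb :=
  Classical.epsilon fun v => v ∈ tangentVectors b.Q x.1 ∧
    ∀ w ∈ tangentVectors b.Q x.1, covector x w = b.kineticMetric x.1 v w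

/-- The body angular velocity `Ω`, as a function on phase space. -/
def Omega (x : PhaseAmb) : Vec3 := angVel x.1 (b.velocity x)

/-- The hamiltonian of the lagrangian: `H = ⟨covector, v⟩ - L(q, v)`. -/
def hamiltonian (x : PhaseAmb) : ℝ :=
  covector x (b.velocity x) - b.lagrangian x.1 (b.velocity x)

/-- The distribution `𝓒` on `𝓜`: the vectors tangent to `𝓜` that project into `D`. -/
def C (x : PhaseAmb) : Set PhaseAmb :=
  {ξ | ξ ∈ tangentVectors b.constraintManifold x ∧ ξ.1 ∈ b.D x.1}

/-- The differential `dH_𝓜` at a point of `𝓜`; only its values on tangent vectors of `𝓜`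
are meaningful. -/
def dHamiltonian (x : PhaseAmb) : PhaseAmb →L[ℝ] ℝ :=
  fderivWithin ℝ b.hamiltonian b.constraintManifold x

/-- The nonholonomic vector field: the section `X` of `𝓒` with
`i_X Ω_𝓜 |_𝓒 = dH_𝓜 |_𝓒`. -/
def Xnh (x : PhaseAmb) : PhaseAmb :=
  Classical.epsilon (Represents (b.C x) (canonicalForm x) (b.dHamiltonian x))

/-- `π_β♯(α) = - X`, where `X` is the vector of `𝓒` with `i_X (Ω_𝓜 + β) |_𝓒 = α |_𝓒`. -/
def gaugeSharp (β : PhaseAmb → PhaseAmb [⋀^Fin 2]→L[ℝ] ℝ) (x : PhaseAmb)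
    (α : PhaseAmb →L[ℝ] ℝ) : PhaseAmb :=
  -Classical.epsilon (Represents (b.C x) (canonicalForm x + β x) α)

/-- The 2-form `β` on `𝓜` defines a dynamical gauge transformation. -/
structure IsDynamicalGaugeTransformation
    (β : PhaseAmb → PhaseAmb [⋀^Fin 2]→L[ℝ] ℝ) : Prop where
  /-- `β` is smooth along `𝓜` -/
  smooth : ContDiffOn ℝ ∞ β b.constraintManifold
  /-- `(Ω_𝓜 + β) |_𝓒` is nondegenerate -/
  nondegenerate : ∀ x ∈ b.constraintManifold,
    NondegenerateOn (b.C x) (canonicalForm x + β x)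
  /-- `i_{X_nh} β = 0` -/
  contraction : ∀ x ∈ b.constraintManifold,
    ∀ ξ ∈ tangentVectors b.constraintManifold x, β x ![b.Xnh x, ξ] = 0

/-- The 2-form `B = m ρ ⟨γ, s⟩ ⟨Ω, dλ⟩`. -/
def B (x : PhaseAmb) : PhaseAmb [⋀^Fin 2]→L[ℝ] ℝ :=
  (b.m * b.ρ (x.1.1 2 2) * (x.1.1 2 ⬝ᵥ b.s (x.1.1 2))) •
    ∑ i, b.Omega x i • dMaurerCartan i x

end BodyOfRevolution

end

noncomputable section

/-! ### Curves and differential forms -/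

/-! The argument is linear algebra in a frame. A rolling velocity is determined by its body angular
velocity, so `D` has rank 3 (`mem_D`), `𝓜` is parametrized by `Q × ℝ³` through `(q, ξ) ↦ (q,
momentum q ξ)` (`mem_constraintManifold`), and `𝓒` is the range of a linear map `frameC` of pairs
`(χ, η)`, where `χ` is the angular velocity of the projection to `Q` and `η` the variation of `ξ`
(`C_eq_range`).

The canonical form pairs a vector `(χ, η)` of `𝓒` with a vertical vector `(0, χ')` to the kinetic
energy product of `χ` and `χ'`, which is positive definite. Any 2-form with this property is
nondegenerate on `𝓒` (`nondegenerateOn_C`). Since `B` is semi-basic, it vanishes on vertical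
vectors, so `Ω_𝓜` and `Ω_𝓜 + B` both have the property.

Testing the equation of `X_nh` on vertical vectors shows that `X_nh` projects to the rolling
velocity of angular velocity `Ω`. By the Maurer-Cartan equation, `⟨Ω, dλ⟩` evaluated on `X_nh` and a
vector of angular velocity `η` is `-⟨Ω, Ω × η⟩ = 0`. Hence `i_{X_nh} B = 0`, and `X_nh` solves the
equation for `Ω_𝓜 + B` as well. The factor `m ρ ⟨γ, s⟩` matters only for smoothness.

Convexity enters through the support function (`hasDerivAt_support`): its derivative makes the
contact relation compatible with rolling. -/

/-- `N` need not be open; a curve that stays in `N` near `t` turns smoothness within `N` into honest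
smoothness in time. -/
theorem ContDiffOn.comp_curve {V W : Type*} [NormedAddCommGroup V] [NormedSpace ℝ V]
    [NormedAddCommGroup W] [NormedSpace ℝ W] {N : Set V} {f : V → W} (hf : ContDiffOn ℝ ∞ f N)
    {c : ℝ → V} {t : ℝ} (hc : ContDiffAt ℝ ∞ c t) (hN : ∀ᶠ r in 𝓝 t, c r ∈ N) :
    ContDiffAt ℝ ∞ (fun r => f (c r)) t :=
  ((hf (c t) hN.self_of_nhds).comp t (s := c ⁻¹' N) hc.contDiffWithinAt
    fun _ h => h).contDiffAt hN

theorem extDeriv_oneForm {V : Type*} [NormedAddCommGroup V] [NormedSpace ℝ V]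
    {θ : V → V →L[ℝ] ℝ} {x : V} (h : DifferentiableAt ℝ θ x) (u v : V) :
    extDeriv (oneForm θ) x ![u, v] =
      fderiv ℝ (fun y => θ y v) x u - fderiv ℝ (fun y => θ y u) x v := by
  have hω : DifferentiableAt ℝ (oneForm θ) x :=
    (ContinuousAlternatingMap.ofSubsingletonLIE (𝕜 := ℝ) (E := V) (F := ℝ)
      (0 : Fin 1)).toContinuousLinearEquiv.differentiableAt.comp x h
  rw [extDeriv_apply hω]
  simp [Fin.sum_univ_two, oneForm, Fin.removeNth, sub_eq_add_neg]

theorem maurerCartan_apply (i : Fin 3) (q w : ConfAmb) :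
    maurerCartan i q w = vee ((Matrix.of q.1)ᵀ * Matrix.of w.1) i := rfl

/-- The value of the Maurer-Cartan form at a fixed velocity, linear in the base point. -/
def maurerCartanFlip (i : Fin 3) (w : ConfAmb) : ConfAmb →L[ℝ] ℝ :=
  LinearMap.toContinuousLinearMap
    { toFun := fun q => maurerCartan i q w
      map_add' := by
        intro u v
        fin_cases i <;>
          simp [maurerCartan_apply, vee, Matrix.mul_apply, Fin.sum_univ_three] <;> ring
      map_smul' := by
        intro r v
        fin_cases i <;>
          simp [maurerCartan_apply, vee, Matrix.mul_apply, Fin.sum_univ_three] <;> ring }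

@[simp] theorem maurerCartanFlip_apply (i : Fin 3) (q w : ConfAmb) :
    maurerCartanFlip i w q = maurerCartan i q w := rfl

theorem hasFDerivAt_maurerCartan (i : Fin 3) (w : ConfAmb) (x : PhaseAmb) :
    HasFDerivAt (fun y : PhaseAmb => maurerCartan i y.1 w)
      ((maurerCartanFlip i w).comp (ContinuousLinearMap.fst ℝ ConfAmb (Vec3 × (Fin 2 → ℝ)))) x :=
  ((maurerCartanFlip i w).comp
    (ContinuousLinearMap.fst ℝ ConfAmb (Vec3 × (Fin 2 → ℝ)))).hasFDerivAt

theorem contDiff_maurerCartan_apply (i : Fin 3) (w : ConfAmb) :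
    ContDiff ℝ ∞ (fun y : PhaseAmb => maurerCartan i y.1 w) :=
  ((maurerCartanFlip i w).comp
    (ContinuousLinearMap.fst ℝ ConfAmb (Vec3 × (Fin 2 → ℝ)))).contDiff

/-- The coefficients of `vee (gᵀ dg)` are linear in `g`, so the exterior derivative does not depend
on the base point. -/
theorem dMaurerCartan_apply (i : Fin 3) (x u v : PhaseAmb) :
    dMaurerCartan i x ![u, v] = maurerCartan i u.1 v.1 - maurerCartan i v.1 u.1 := by
  have h : ContDiff ℝ ∞ fun y : PhaseAmb =>
      (maurerCartan i y.1).comp (ContinuousLinearMap.fst ℝ ConfAmb (Vec3 × (Fin 2 → ℝ))) :=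
    contDiff_clm_apply_iff.2 fun w => contDiff_maurerCartan_apply i w.1
  rw [dMaurerCartan, extDeriv_oneForm (h.differentiable (by simp) x)]
  simp [(hasFDerivAt_maurerCartan i _ x).fderiv]

theorem liouville_apply (x v : PhaseAmb) :
    liouville x v = ∑ i, x.2.1 i * maurerCartan i x.1 v.1 + ∑ j, x.2.2 j * daForm j v.1 := by
  simp [liouville, covector]

theorem contDiff_liouville : ContDiff ℝ ∞ liouville := by
  refine contDiff_clm_apply_iff.2 fun w => ?_
  simp only [liouville_apply]
  have h := fun i => contDiff_maurerCartan_apply i w.1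
  fun_prop

theorem fderiv_liouville_apply (x u v : PhaseAmb) :
    fderiv ℝ (fun y => liouville y v) x u =
      ∑ i, (u.2.1 i * maurerCartan i x.1 v.1 + x.2.1 i * maurerCartan i u.1 v.1) +
        ∑ j, u.2.2 j * daForm j v.1 := by
  simp only [liouville_apply]
  have h1 := fun i : Fin 3 => (((ContinuousLinearMap.proj (R := ℝ) (φ := fun _ : Fin 3 => ℝ) i).comp
    (ContinuousLinearMap.fst ℝ Vec3 (Fin 2 → ℝ))).comp
      (ContinuousLinearMap.snd ℝ ConfAmb (Vec3 × (Fin 2 → ℝ)))).hasFDerivAt (x := x)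
  have h2 := fun j : Fin 2 => (((ContinuousLinearMap.proj (R := ℝ) (φ := fun _ : Fin 2 => ℝ) j).comp
    (ContinuousLinearMap.snd ℝ Vec3 (Fin 2 → ℝ))).comp
      (ContinuousLinearMap.snd ℝ ConfAmb (Vec3 × (Fin 2 → ℝ)))).hasFDerivAt (x := x)
  have h := (HasFDerivAt.fun_sum (u := Finset.univ) fun i _ =>
    (h1 i).mul (hasFDerivAt_maurerCartan i v.1 x)).add
      (HasFDerivAt.fun_sum (u := Finset.univ) fun j _ => (h2 j).mul_const (daForm j v.1))
  refine (congrArg (fun f => f u) h.fderiv).trans ?_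
  simp only [add_apply, sum_apply]
  congr 1
  · refine Finset.sum_congr rfl fun i _ => ?_
    simp; ring
  · refine Finset.sum_congr rfl fun i _ => ?_
    simp; ring

theorem canonicalForm_apply (x u v : PhaseAmb) :
    canonicalForm x ![u, v] =
      ∑ i, (v.2.1 i * maurerCartan i x.1 u.1 + x.2.1 i * maurerCartan i v.1 u.1) +
        ∑ j, v.2.2 j * daForm j u.1 -
      (∑ i, (u.2.1 i * maurerCartan i x.1 v.1 + x.2.1 i * maurerCartan i u.1 v.1) +
        ∑ j, u.2.2 j * daForm j v.1) := by
  rw [canonicalForm, ContinuousAlternatingMap.neg_apply,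
    extDeriv_oneForm (contDiff_liouville.differentiable (by simp) x), fderiv_liouville_apply,
    fderiv_liouville_apply, neg_sub]

/-- If the restriction of a 2-form to the range of a linear map is nondegenerate, then every
functional is uniquely represented there. -/
theorem existsUnique_represents {E V : Type*} [AddCommGroup E] [Module ℝ E] [FiniteDimensional ℝ E]
    [NormedAddCommGroup V] [NormedSpace ℝ V] (J : E →ₗ[ℝ] V) {W : Set V} (hW : W = Set.range J)
    (σ : V [⋀^Fin 2]→L[ℝ] ℝ) (hσ : NondegenerateOn W σ) (α : V →L[ℝ] ℝ) :
    ∃! X, Represents W σ α X := by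
  have hadd : ∀ a a' v, σ ![a + a', v] = σ ![a, v] + σ ![a', v] := fun a a' v => by
    exact σ.toMultilinearMap.cons_add ![v] a a'
  have hsmul : ∀ (r : ℝ) a v, σ ![r • a, v] = r * σ ![a, v] := fun r a v => by
    exact σ.toMultilinearMap.cons_smul ![v] r a
  have hswap : ∀ a v, σ ![a, v] = -σ ![v, a] := fun a v => by
    have := σ.toAlternatingMap.map_swap ![v, a] (i := 0) (j := 1) (by decide)
    rw [← ContinuousAlternatingMap.coe_toAlternatingMap, ← this]
    congr 1
    ext i
    fin_cases i <;> rfl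
  have hadd' : ∀ a v v', σ ![a, v + v'] = σ ![a, v] + σ ![a, v'] := fun a v v' => by
    rw [hswap, hadd, hswap v, hswap v']; ring
  have hsmul' : ∀ (r : ℝ) a v, σ ![a, r • v] = r * σ ![a, v] := fun r a v => by
    rw [hswap, hsmul, hswap v]; ring
  let R := LinearMap.range J
  have hR : ∀ w, w ∈ W ↔ w ∈ R := fun w => by rw [hW]; rfl
  let T : R →ₗ[ℝ] Module.Dual ℝ R :=
    { toFun := fun a =>
        { toFun := fun v => σ ![(a : V), (v : V)]
          map_add' := fun v v' => hadd' _ _ _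
          map_smul' := fun r v => hsmul' _ _ _ }
      map_add' := fun a a' => LinearMap.ext fun v => hadd _ _ _
      map_smul' := fun r a => LinearMap.ext fun v => hsmul _ _ _ }
  have hT : Function.Injective T := by
    rw [← LinearMap.ker_eq_bot, LinearMap.ker_eq_bot']
    intro a ha
    refine Subtype.ext (hσ a ((hR _).2 a.2) fun v hv => ?_)
    exact LinearMap.congr_fun ha ⟨v, (hR v).1 hv⟩
  have hS : Function.Surjective T :=
    (LinearMap.injective_iff_surjective_of_finrank_eq_finrank
      Subspace.dual_finrank_eq.symm).1 hT
  obtain ⟨X, hX⟩ := hS ((α : V →ₗ[ℝ] ℝ).comp R.subtype)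
  refine ⟨X, ⟨(hR _).2 X.2, fun v hv => LinearMap.congr_fun hX ⟨v, (hR v).1 hv⟩⟩, ?_⟩
  rintro Y ⟨hY, hYα⟩
  have : (⟨Y, (hR _).1 hY⟩ : R) = X := hT <| by
    rw [hX]
    exact LinearMap.ext fun v => hYα v ((hR _).2 v.2)
  exact congrArg Subtype.val this

end

noncomputable section

/-! ### Rotations -/

/-- The skew-symmetric matrix of the map `v ↦ τ × v`. -/
def hatMatrix (τ : Vec3) : Mat3 := !![0, -τ 2, τ 1; τ 2, 0, -τ 0; -τ 1, τ 0, 0]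

theorem hatMatrix_vee {A : Mat3} (hA : Aᵀ = -A) : hatMatrix (vee A) = A := by
  have h : ∀ i j, A j i = -A i j := fun i j => congrFun (congrFun hA i) j
  have h0 := h 0 0
  have h1 := h 1 1
  have h2 := h 2 2
  ext i j
  fin_cases i <;> fin_cases j <;> simp [hatMatrix, vee, h 0 1, h 1 2, h 2 0] <;>
    linarith

/-- With `A = hatMatrix τ` skew and `A³ = -|τ|² A`, the product `RᵀR` is `1 + (2h - f² - |τ|² h²)
A²`. -/
theorem rodrigues_mem_specialOrthogonalGroup (τ : Vec3) {f h : ℝ}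
    (hfh : 2 * h - f ^ 2 - (τ ⬝ᵥ τ) * h ^ 2 = 0) :
    1 + f • hatMatrix τ + h • (hatMatrix τ * hatMatrix τ) ∈
      Matrix.specialOrthogonalGroup (Fin 3) ℝ := by
  rw [Matrix.mem_specialOrthogonalGroup_iff, Matrix.mem_orthogonalGroup_iff']
  have hn : τ ⬝ᵥ τ = τ 0 ^ 2 + τ 1 ^ 2 + τ 2 ^ 2 := by
    rw [Matrix.vec3_dotProduct]; ring
  rw [hn] at hfh
  constructor
  · have : (1 + f • hatMatrix τ + h • (hatMatrix τ * hatMatrix τ))ᵀ *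
        (1 + f • hatMatrix τ + h • (hatMatrix τ * hatMatrix τ)) =
        1 + (2 * h - f ^ 2 - (τ 0 ^ 2 + τ 1 ^ 2 + τ 2 ^ 2) * h ^ 2) •
          (hatMatrix τ * hatMatrix τ) := by
      ext i j
      fin_cases i <;> fin_cases j <;>
        simp [hatMatrix, Matrix.mul_apply, Fin.sum_univ_three] <;> ring
    rw [this, hfh, zero_smul, add_zero]
  · rw [Matrix.det_fin_three]
    simp only [hatMatrix, Matrix.add_apply, Matrix.smul_apply, Matrix.mul_apply,
      Fin.sum_univ_three, Matrix.of_apply, Matrix.cons_val, smul_eq_mul, Matrix.one_apply]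
    simp
    -- The determinant is `(1 - |τ|² h)² + |τ|² f² = 1 - |τ|² (2h - f² - |τ|² h²)`.
    linear_combination (-(τ 0 ^ 2 + τ 1 ^ 2 + τ 2 ^ 2)) * hfh

theorem row_mul_hatMatrix (g : Fin 3 → Vec3) (τ : Vec3) :
    Matrix.of g * hatMatrix τ = Matrix.of fun i => g i ⨯₃ τ := by
  ext i j
  fin_cases j <;> simp [hatMatrix, Matrix.mul_apply, Fin.sum_univ_three, cross_apply] <;> ring

/-- A smooth curve of rotations through `g` with body angular velocity `τ` at time `0`. -/
def rotationCurve (g : Fin 3 → Vec3) (τ : Vec3) (t : ℝ) : Fin 3 → Vec3 :=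
  fun i => g i + (t / (1 + t ^ 2 * (τ ⬝ᵥ τ) / 4)) • (g i ⨯₃ τ) +
    (t ^ 2 / 2 / (1 + t ^ 2 * (τ ⬝ᵥ τ) / 4)) • ((g i ⨯₃ τ) ⨯₃ τ)

theorem dotProduct_self_nonneg' (τ : Vec3) : 0 ≤ τ ⬝ᵥ τ := by
  rw [Matrix.vec3_dotProduct]
  nlinarith [mul_self_nonneg (τ 0), mul_self_nonneg (τ 1), mul_self_nonneg (τ 2)]

theorem rotationCurve_denom_pos (τ : Vec3) (t : ℝ) : 0 < 1 + t ^ 2 * (τ ⬝ᵥ τ) / 4 := by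
  have := mul_nonneg (sq_nonneg t) (dotProduct_self_nonneg' τ)
  linarith

theorem rotationCurve_mem {g : Fin 3 → Vec3}
    (hg : Matrix.of g ∈ Matrix.specialOrthogonalGroup (Fin 3) ℝ) (τ : Vec3) (t : ℝ) :
    Matrix.of (rotationCurve g τ t) ∈ Matrix.specialOrthogonalGroup (Fin 3) ℝ := by
  have hd := (rotationCurve_denom_pos τ t).ne'
  -- These coefficients are those of the Cayley transform of `(t/2) hatMatrix τ`, a rational
  -- substitute for the exponential.
  have h := rodrigues_mem_specialOrthogonalGroup τ
    (f := t / (1 + t ^ 2 * (τ ⬝ᵥ τ) / 4)) (h := t ^ 2 / 2 / (1 + t ^ 2 * (τ ⬝ᵥ τ) / 4)) (by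
      generalize τ ⬝ᵥ τ = n at *
      obtain ⟨d, hdef⟩ : ∃ d, d = 1 + t ^ 2 * n / 4 := ⟨_, rfl⟩
      rw [← hdef] at hd ⊢
      field_simp
      rw [hdef]
      ring)
  convert mul_mem hg h using 1
  rw [mul_add, mul_add, mul_one, mul_smul_comm, mul_smul_comm, ← mul_assoc, row_mul_hatMatrix,
    row_mul_hatMatrix]
  rfl

theorem rotationCurve_zero (g : Fin 3 → Vec3) (τ : Vec3) : rotationCurve g τ 0 = g := by
  ext i j
  simp [rotationCurve]

theorem contDiff_rotationCurve (g : Fin 3 → Vec3) (τ : Vec3) :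
    ContDiff ℝ ∞ (rotationCurve g τ) := by
  have hd : ∀ t, 1 + t ^ 2 * (τ ⬝ᵥ τ) / 4 ≠ 0 := fun t => (rotationCurve_denom_pos τ t).ne'
  have h : ContDiff ℝ ∞ fun t : ℝ => 1 + t ^ 2 * (τ ⬝ᵥ τ) / 4 := by fun_prop
  refine contDiff_pi.2 fun i => ?_
  have h1 : ContDiff ℝ ∞ fun t : ℝ => t / (1 + t ^ 2 * (τ ⬝ᵥ τ) / 4) := contDiff_id.div h hd
  have h2 : ContDiff ℝ ∞ fun t : ℝ => t ^ 2 / 2 / (1 + t ^ 2 * (τ ⬝ᵥ τ) / 4) :=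
    ContDiff.div (by fun_prop) h hd
  exact (contDiff_const.add (h1.smul contDiff_const)).add (h2.smul contDiff_const)

theorem hasDerivAt_rotationCurve (g : Fin 3 → Vec3) (τ : Vec3) :
    HasDerivAt (rotationCurve g τ) (fun i => g i ⨯₃ τ) 0 := by
  have h : HasDerivAt (fun t : ℝ => 1 + t ^ 2 * (τ ⬝ᵥ τ) / 4) 0 0 := by
    have := ((((hasDerivAt_id (0 : ℝ)).pow 2).mul_const (τ ⬝ᵥ τ)).div_const 4).const_add 1
    simpa using this
  have h1 := (hasDerivAt_id (0 : ℝ)).div h (by simp)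
  have h2 := (((hasDerivAt_id (0 : ℝ)).pow 2).div_const 2).div h (by simp)
  refine hasDerivAt_pi.2 fun i => ?_
  have := ((h1.smul_const (g i ⨯₃ τ)).const_add (g i)).add (h2.smul_const ((g i ⨯₃ τ) ⨯₃ τ))
  simp only [id, Pi.pow_apply] at this
  norm_num at this
  exact this

theorem mulVec_dotProduct_mulVec {A : Mat3} (hA : Aᵀ * A = 1) (v w : Vec3) :
    (A *ᵥ v) ⬝ᵥ (A *ᵥ w) = v ⬝ᵥ w := by
  rw [Matrix.dotProduct_mulVec, Matrix.vecMul_mulVec, ← Matrix.dotProduct_mulVec, hA,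
    Matrix.one_mulVec]

theorem vee_hatMatrix (τ : Vec3) : vee (hatMatrix τ) = τ := by
  ext i
  fin_cases i <;> simp [vee, hatMatrix]

theorem angVel_eq {q w : ConfAmb} (hq : (Matrix.of q.1)ᵀ * Matrix.of q.1 = 1) {τ : Vec3}
    (hw : w.1 = fun i => q.1 i ⨯₃ τ) : angVel q w = τ := by
  ext i
  rw [angVel, maurerCartan_apply, hw, ← row_mul_hatMatrix, ← mul_assoc, hq, one_mul,
    vee_hatMatrix]

/-- The Maurer-Cartan equation `dλ = -λ × λ`. -/
theorem maurerCartan_sub_swap {q u v : ConfAmb} (hq : (Matrix.of q.1)ᵀ * Matrix.of q.1 = 1)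
    {ξ η : Vec3} (hu : u.1 = fun i => q.1 i ⨯₃ ξ) (hv : v.1 = fun i => q.1 i ⨯₃ η) (i : Fin 3) :
    maurerCartan i u v - maurerCartan i v u = -(ξ ⨯₃ η) i := by
  have hT : ∀ τ : Vec3, (hatMatrix τ)ᵀ = -hatMatrix τ := fun τ => by
    ext i j
    fin_cases i <;> fin_cases j <;> simp [hatMatrix]
  -- Orthogonality removes `g`; what remains is minus the commutator of the two skew matrices, the
  -- matrix of `-(ξ × η)`.
  have h : ∀ a c : Vec3, (Matrix.of q.1 * hatMatrix a)ᵀ * (Matrix.of q.1 * hatMatrix c) =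
      -(hatMatrix a * hatMatrix c) := fun a c => by
    rw [Matrix.transpose_mul, mul_assoc, ← mul_assoc _ (Matrix.of q.1), hq, one_mul, hT, neg_mul]
  rw [maurerCartan_apply, maurerCartan_apply, hu, hv, ← row_mul_hatMatrix, ← row_mul_hatMatrix,
    h, h]
  fin_cases i <;>
    simp [vee, hatMatrix, cross_apply] <;> ring

/-! ### The configuration space -/

theorem daForm_apply (j : Fin 2) (w : ConfAmb) : daForm j w = w.2 j.castSucc := rfl

theorem HasDerivAt.dotProduct_curve {u v : ℝ → Vec3} {u' v' : Vec3} {t : ℝ}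
    (hu : HasDerivAt u u' t) (hv : HasDerivAt v v' t) :
    HasDerivAt (fun r => u r ⬝ᵥ v r) (u' ⬝ᵥ v t + u t ⬝ᵥ v') t := by
  rw [hasDerivAt_pi] at hu hv
  refine (HasDerivAt.fun_sum (u := Finset.univ) fun i _ => (hu i).mul (hv i)).congr_deriv ?_
  simp only [dotProduct, Finset.sum_add_distrib]

namespace BodyOfRevolution

variable (b : BodyOfRevolution)

/-- The covector of `-ȧ₃` as a function of the body angular velocity. -/
def lever (q : ConfAmb) : Vec3 := b.s (q.1 2) ⨯₃ q.1 2

variable {b}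

theorem Q.transpose_mul_self {q : ConfAmb} (hq : q ∈ b.Q) :
    (Matrix.of q.1)ᵀ * Matrix.of q.1 = 1 :=
  (Matrix.mem_orthogonalGroup_iff' (Fin 3) ℝ).1 (Matrix.mem_specialOrthogonalGroup_iff.1 hq.1).1

theorem Q.row_dotProduct {q : ConfAmb} (hq : q ∈ b.Q) : q.1 2 ⬝ᵥ q.1 2 = 1 := by
  have h : Matrix.of q.1 * (Matrix.of q.1)ᵀ = 1 :=
    (Matrix.mem_orthogonalGroup_iff (Fin 3) ℝ).1 (Matrix.mem_specialOrthogonalGroup_iff.1 hq.1).1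
  have := congrFun (congrFun h 2) 2
  simpa [Matrix.mul_apply, dotProduct] using this

theorem contDiffOn_s (b : BodyOfRevolution) : ContDiffOn ℝ ∞ b.s {γ | γ ⬝ᵥ γ = 1} := by
  have hmaps : Set.MapsTo (fun γ : Vec3 => γ 2) {γ | γ ⬝ᵥ γ = 1} (Set.Icc (-1) 1) := by
    intro γ hγ
    have hγ : γ ⬝ᵥ γ = 1 := hγ
    rw [Matrix.vec3_dotProduct] at hγ
    constructor <;> nlinarith [mul_self_nonneg (γ 0), mul_self_nonneg (γ 1)]
  have h2 : ContDiffOn ℝ ∞ (fun γ : Vec3 => γ 2) {γ | γ ⬝ᵥ γ = 1} := by fun_prop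
  have hρ := b.ρ_smooth.comp h2 hmaps
  have hζ := b.ζ_smooth.comp h2 hmaps
  refine contDiffOn_pi.2 fun i => ?_
  fin_cases i
  · exact hρ.mul (by fun_prop)
  · exact hρ.mul (by fun_prop)
  · exact hζ

/-- The support function `⟨γ, s(γ)⟩` has differential `⟨dγ, s(γ)⟩`. -/
theorem hasDerivAt_support (b : BodyOfRevolution) {γ : ℝ → Vec3} {γ' : Vec3} {t : ℝ}
    (hγ : ContDiffAt ℝ ∞ γ t) (hγ' : HasDerivAt γ γ' t) (h1 : ∀ᶠ r in 𝓝 t, γ r ⬝ᵥ γ r = 1) :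
    HasDerivAt (fun r => γ r ⬝ᵥ b.s (γ r)) (γ' ⬝ᵥ b.s (γ t)) t := by
  have hs := ((b.contDiffOn_s.comp_curve hγ h1).differentiableAt (by simp)).hasDerivAt
  have h0 := (hasDerivAt_const t (γ t)).dotProduct_curve hs
  -- The inward normal `γ t` makes `s(γ t)` a minimum of `⟨γ t, ·⟩` on `K`, so moving the contact
  -- point contributes nothing to first order.
  have hmin : IsLocalMin (fun r => γ t ⬝ᵥ b.s (γ r)) t := by
    filter_upwards [h1] with r hr
    have hK := (b.gauss (γ t) h1.self_of_nhds).2.2 (b.s (γ r))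
      (b.isStronglyConvexBody.isCompact.isClosed.frontier_subset (b.gauss (γ r) hr).1)
    rw [dotProduct_sub] at hK
    exact sub_nonneg.1 hK
  have hzero := hmin.hasDerivAt_eq_zero h0
  have := hγ'.dotProduct_curve hs
  rw [zero_dotProduct, zero_add] at hzero
  rwa [hzero, add_zero] at this

theorem cross_dotProduct_s (q : ConfAmb) (τ : Vec3) :
    (q.1 2 ⨯₃ τ) ⬝ᵥ b.s (q.1 2) = τ ⬝ᵥ b.lever q := by
  rw [lever, dotProduct_comm, triple_product_permutation, triple_product_permutation]

/-- Differentiating `gᵀg = 1` and the contact relation gives the two conditions. They are sufficient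
because an explicit curve realizes any `τ`, `ȧ₁`, `ȧ₂`. -/
theorem mem_tangentVectors_Q {q : ConfAmb} (hq : q ∈ b.Q) (w : ConfAmb) :
    w ∈ tangentVectors b.Q q ↔
      ∃ τ : Vec3, (w.1 = fun i => q.1 i ⨯₃ τ) ∧ w.2 2 = -(τ ⬝ᵥ b.lever q) := by
  constructor
  · rintro ⟨c, hc, rfl, hcQ, hc'⟩
    have hg : HasDerivAt (fun t => (c t).1) w.1 0 := hc'.fst
    have ha : HasDerivAt (fun t => (c t).2) w.2 0 := hc'.snd
    have hgs : ContDiffAt ℝ ∞ (fun t => (c t).1) 0 := contDiffAt_fst.comp 0 hc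
    have hentry : ∀ i j, HasDerivAt (fun t => (c t).1 i j) (w.1 i j) 0 := fun i j =>
      hasDerivAt_pi.1 (hasDerivAt_pi.1 hg i) j
    set A : Mat3 := (Matrix.of (c 0).1)ᵀ * Matrix.of w.1 with hA
    have hskew : Aᵀ = -A := by
      ext i j
      have h1 : HasDerivAt (fun t => ∑ k, (c t).1 k j * (c t).1 k i)
          (∑ k, (w.1 k j * (c 0).1 k i + (c 0).1 k j * w.1 k i)) 0 :=
        HasDerivAt.fun_sum fun k _ => (hentry k j).mul (hentry k i)
      have h2 : HasDerivAt (fun t => ∑ k, (c t).1 k j * (c t).1 k i) 0 0 := by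
        refine (hasDerivAt_const (0 : ℝ) ((1 : Mat3) j i)).congr_of_eventuallyEq ?_
        filter_upwards [hcQ] with t ht
        have := congrFun (congrFun (Q.transpose_mul_self ht) j) i
        simpa [Matrix.mul_apply] using this
      have h := h1.unique h2
      rw [Finset.sum_add_distrib] at h
      simp only [hA, Matrix.transpose_apply, Matrix.neg_apply, Matrix.mul_apply, Matrix.of_apply]
      rw [eq_neg_iff_add_eq_zero, add_comm]
      refine (congrArg (· + _) ?_).trans h
      exact Finset.sum_congr rfl fun k _ => mul_comm _ _
    have hw : w.1 = fun i => (c 0).1 i ⨯₃ vee A := by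
      apply Matrix.of.injective
      rw [← row_mul_hatMatrix, hatMatrix_vee hskew, hA, ← mul_assoc,
        mul_eq_one_comm.1 (Q.transpose_mul_self hq), one_mul]
    refine ⟨vee A, hw, ?_⟩
    have h1 := (hasDerivAt_support b (γ := fun t => (c t).1 2) (contDiffAt_pi.1 hgs 2)
      (hasDerivAt_pi.1 hg 2) (hcQ.mono fun t ht => Q.row_dotProduct ht)).neg
    have h2 : HasDerivAt (fun t => -((c t).1 2 ⬝ᵥ b.s ((c t).1 2))) (w.2 2) 0 :=
      (hasDerivAt_pi.1 ha 2).congr_of_eventuallyEq (hcQ.mono fun t ht => ht.2.symm)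
    rw [h2.unique h1, ← cross_dotProduct_s, hw]
  · rintro ⟨τ, hw1, hw2⟩
    -- The rotation follows a Cayley curve, `a₁` and `a₂` move linearly, and `a₃` is dictated by
    -- contact.
    let γ : ℝ → Vec3 := fun t => rotationCurve q.1 τ t 2
    let c : ℝ → ConfAmb := fun t => (rotationCurve q.1 τ t,
      ![q.2 0 + t * w.2 0, q.2 1 + t * w.2 1, -(γ t ⬝ᵥ b.s (γ t))])
    have hcQ : ∀ t, c t ∈ b.Q := fun t => ⟨rotationCurve_mem hq.1 τ t, by simp [c, γ]⟩
    have hγs : ContDiff ℝ ∞ γ := contDiff_pi.1 (contDiff_rotationCurve q.1 τ) 2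
    have hγ1 : ∀ t, γ t ⬝ᵥ γ t = 1 := fun t => Q.row_dotProduct (hcQ t)
    have hγ' : HasDerivAt γ (q.1 2 ⨯₃ τ) 0 :=
      hasDerivAt_pi.1 (hasDerivAt_rotationCurve q.1 τ) 2
    have hγ0 : γ 0 = q.1 2 := congrFun (rotationCurve_zero q.1 τ) 2
    have hss := b.contDiffOn_s.comp_curve (hγs.contDiffAt (x := 0)) (.of_forall hγ1)
    refine ⟨c, ?_, ?_, .of_forall hcQ, ?_⟩
    · refine (contDiff_rotationCurve q.1 τ).contDiffAt.prodMk (contDiffAt_pi.2 fun i => ?_)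
      fin_cases i
      · simp; fun_prop
      · simp; fun_prop
      · exact (ContDiffAt.sum fun i _ => (contDiffAt_pi.1 hγs.contDiffAt i).mul
          (contDiffAt_pi.1 hss i)).neg
    · refine Prod.ext (rotationCurve_zero q.1 τ) ?_
      ext i
      fin_cases i
      · simp [c]
      · simp [c]
      · simpa [c, hγ0] using hq.2.symm
    · rw [show w = (w.1, w.2) from rfl, hw1]
      refine (hasDerivAt_rotationCurve q.1 τ).prodMk (hasDerivAt_pi.2 fun i => ?_)
      fin_cases i
      · simpa using ((hasDerivAt_id (0 : ℝ)).mul_const (w.2 0)).const_add (q.2 0)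
      · simpa using ((hasDerivAt_id (0 : ℝ)).mul_const (w.2 1)).const_add (q.2 1)
      · have := (hasDerivAt_support b hγs.contDiffAt hγ' (.of_forall hγ1)).neg
        rw [hγ0, cross_dotProduct_s, ← hw2] at this
        exact this

end BodyOfRevolution

end

noncomputable section

/-! ### Smoothness of vector operations -/

theorem ContDiffOn.dotProduct_vec3 {V : Type*} [NormedAddCommGroup V] [NormedSpace ℝ V]
    {N : Set V} {u v : V → Vec3} (hu : ContDiffOn ℝ ∞ u N) (hv : ContDiffOn ℝ ∞ v N) :
    ContDiffOn ℝ ∞ (fun x => u x ⬝ᵥ v x) N :=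
  ContDiffOn.sum fun i _ => (contDiffOn_pi.1 hu i).mul (contDiffOn_pi.1 hv i)

theorem ContDiffOn.crossProduct_vec3 {V : Type*} [NormedAddCommGroup V] [NormedSpace ℝ V]
    {N : Set V} {u v : V → Vec3} (hu : ContDiffOn ℝ ∞ u N) (hv : ContDiffOn ℝ ∞ v N) :
    ContDiffOn ℝ ∞ (fun x => u x ⨯₃ v x) N := by
  rw [contDiffOn_pi] at hu hv
  refine contDiffOn_pi.2 fun i => ?_
  fin_cases i
  · exact ((hu 1).mul (hv 2)).sub ((hu 2).mul (hv 1))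
  · exact ((hu 2).mul (hv 0)).sub ((hu 0).mul (hv 2))
  · exact ((hu 0).mul (hv 1)).sub ((hu 1).mul (hv 0))

namespace BodyOfRevolution

variable (b : BodyOfRevolution)

/-! ### The Legendre transformation -/

/-- The velocity of the body rolling without slipping with body angular velocity `ξ`. -/
def rollVelocity (q : ConfAmb) : Vec3 →ₗ[ℝ] ConfAmb where
  toFun ξ := (fun i => q.1 i ⨯₃ ξ, -(Matrix.of q.1 *ᵥ (ξ ⨯₃ b.s (q.1 2))))
  map_add' ξ η := by
    refine Prod.ext (funext fun i => by simp) ?_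
    simp [Matrix.mulVec_add, add_comm]
  map_smul' r ξ := by
    refine Prod.ext (funext fun i => by simp) ?_
    simp [Matrix.mulVec_smul]

/-- The kinetic energy metric on rolling velocities, in terms of body angular velocities. -/
def rollMetric (q : ConfAmb) (ξ η : Vec3) : ℝ :=
  (b.inertia *ᵥ ξ) ⬝ᵥ η + b.m * ((ξ ⨯₃ b.s (q.1 2)) ⬝ᵥ (η ⨯₃ b.s (q.1 2)))

/-- The components of the image of a rolling velocity under the Legendre transformation. -/
def momentum (q : ConfAmb) : Vec3 →ₗ[ℝ] Vec3 × (Fin 2 → ℝ) where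
  toFun ξ := (b.inertia *ᵥ ξ + (b.m * (ξ ⬝ᵥ b.lever q)) • b.lever q,
    fun j => b.m * (b.rollVelocity q ξ).2 j.castSucc)
  map_add' ξ η := by
    refine Prod.ext ?_ (funext fun j => ?_)
    · simp only [Matrix.mulVec_add, add_dotProduct, Prod.mk_add_mk]
      module
    · simp [mul_add]
  map_smul' r ξ := by
    refine Prod.ext ?_ (funext fun j => ?_)
    · simp only [Matrix.mulVec_smul, smul_dotProduct, smul_eq_mul, Prod.smul_mk, RingHom.id_apply]
      module
    · simp; ring

variable {b}

theorem rollVelocity_fst (q : ConfAmb) (ξ : Vec3) :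
    (b.rollVelocity q ξ).1 = fun i => q.1 i ⨯₃ ξ := rfl

theorem rollVelocity_snd (q : ConfAmb) (ξ : Vec3) :
    (b.rollVelocity q ξ).2 = -(Matrix.of q.1 *ᵥ (ξ ⨯₃ b.s (q.1 2))) := rfl

theorem rollVelocity_snd_two (q : ConfAmb) (ξ : Vec3) :
    (b.rollVelocity q ξ).2 2 = -(ξ ⬝ᵥ b.lever q) := by
  rw [lever, triple_product_permutation, triple_product_permutation]
  rfl

theorem rollVelocity_mem_tangentVectors {q : ConfAmb} (hq : q ∈ b.Q) (ξ : Vec3) :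
    b.rollVelocity q ξ ∈ tangentVectors b.Q q :=
  (mem_tangentVectors_Q hq _).2 ⟨ξ, rfl, rollVelocity_snd_two q ξ⟩

/-- The third component of the no-slip equation is the derivative of the contact relation, so
tangency to `Q` imposes nothing more on a rolling velocity. -/
theorem mem_D {q : ConfAmb} (hq : q ∈ b.Q) (w : ConfAmb) :
    w ∈ b.D q ↔ ∃ ξ, w = b.rollVelocity q ξ := by
  constructor
  · rintro ⟨hw, h2⟩
    obtain ⟨ξ, h1, -⟩ := (mem_tangentVectors_Q hq _).1 hw
    rw [angVel_eq (Q.transpose_mul_self hq) h1] at h2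
    exact ⟨ξ, Prod.ext h1 h2⟩
  · rintro ⟨ξ, rfl⟩
    refine ⟨rollVelocity_mem_tangentVectors hq ξ, ?_⟩
    rw [angVel_eq (Q.transpose_mul_self hq) (rollVelocity_fst q ξ)]
    rfl

theorem inertia_mulVec (b : BodyOfRevolution) (ξ : Vec3) :
    b.inertia *ᵥ ξ = ![b.I₁ * ξ 0, b.I₁ * ξ 1, b.I₃ * ξ 2] := by
  ext i
  fin_cases i <;> simp [inertia, Matrix.mulVec_diagonal]

theorem eq_zero_of_inertia {ξ : Vec3} (h : (b.inertia *ᵥ ξ) ⬝ᵥ ξ ≤ 0) : ξ = 0 := by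
  rw [inertia_mulVec, Matrix.vec3_dotProduct] at h
  simp only [Matrix.cons_val] at h
  have h1 := b.I₁_pos
  have h3 := b.I₃_pos
  have e0 := mul_nonneg h1.le (mul_self_nonneg (ξ 0))
  have e1 := mul_nonneg h1.le (mul_self_nonneg (ξ 1))
  have e2 := mul_nonneg h3.le (mul_self_nonneg (ξ 2))
  have z0 : b.I₁ * (ξ 0 * ξ 0) = 0 := by linarith
  have z1 : b.I₁ * (ξ 1 * ξ 1) = 0 := by linarith
  have z2 : b.I₃ * (ξ 2 * ξ 2) = 0 := by linarith
  ext i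
  fin_cases i
  · simpa [h1.ne'] using z0
  · simpa [h1.ne'] using z1
  · simpa [h3.ne'] using z2

theorem eq_zero_of_rollMetric {q : ConfAmb} {ξ : Vec3} (h : b.rollMetric q ξ ξ = 0) : ξ = 0 := by
  have := mul_nonneg b.m_pos.le (dotProduct_self_nonneg' (ξ ⨯₃ b.s (q.1 2)))
  rw [rollMetric] at h
  exact eq_zero_of_inertia (by linarith)

theorem rollMetric_comm (q : ConfAmb) (ξ η : Vec3) :
    b.rollMetric q ξ η = b.rollMetric q η ξ := by
  rw [rollMetric, rollMetric, dotProduct_comm (ξ ⨯₃ _), inertia_mulVec, inertia_mulVec,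
    Matrix.vec3_dotProduct _ η, Matrix.vec3_dotProduct _ ξ]
  simp only [Matrix.cons_val]
  ring

theorem kineticMetric_eq {q v w : ConfAmb} (hq : q ∈ b.Q) {ξ η : Vec3}
    (hv : v.1 = fun i => q.1 i ⨯₃ ξ) (hw : w.1 = fun i => q.1 i ⨯₃ η) :
    b.kineticMetric q v w = (b.inertia *ᵥ ξ) ⬝ᵥ η + b.m * (v.2 ⬝ᵥ w.2) := by
  rw [kineticMetric, angVel_eq (Q.transpose_mul_self hq) hv,
    angVel_eq (Q.transpose_mul_self hq) hw]

theorem rollVelocity_dotProduct {q : ConfAmb} (hq : q ∈ b.Q) (ξ η : Vec3) :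
    (b.rollVelocity q ξ).2 ⬝ᵥ (b.rollVelocity q η).2 =
      (ξ ⨯₃ b.s (q.1 2)) ⬝ᵥ (η ⨯₃ b.s (q.1 2)) := by
  rw [rollVelocity_snd, rollVelocity_snd, neg_dotProduct_neg,
    mulVec_dotProduct_mulVec (Q.transpose_mul_self hq)]

theorem kineticMetric_rollVelocity {q : ConfAmb} (hq : q ∈ b.Q) (ξ η : Vec3) :
    b.kineticMetric q (b.rollVelocity q ξ) (b.rollVelocity q η) = b.rollMetric q ξ η := by
  rw [kineticMetric_eq hq (rollVelocity_fst q ξ) (rollVelocity_fst q η),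
    rollVelocity_dotProduct hq, rollMetric]

theorem covector_eq {x : PhaseAmb} (hq : x.1 ∈ b.Q) {w : ConfAmb} {η : Vec3}
    (hw : w.1 = fun i => x.1.1 i ⨯₃ η) :
    covector x w = x.2.1 ⬝ᵥ η + ∑ j : Fin 2, x.2.2 j * w.2 j.castSucc := by
  have h : ∀ i, maurerCartan i x.1 w = η i :=
    congrFun (angVel_eq (Q.transpose_mul_self hq) hw)
  simp [covector, h, daForm_apply, dotProduct]

/-- On `Q` the form `da₃` equals `-⟨lever, λ⟩` and is absent from the frame; its share of the
momentum is the rank one term in `momentum`. -/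
theorem momentum_pairing {q : ConfAmb} (ξ : Vec3) {w : ConfAmb} {η : Vec3}
    (hw : w.2 2 = -(η ⬝ᵥ b.lever q)) :
    (b.momentum q ξ).1 ⬝ᵥ η + ∑ j : Fin 2, (b.momentum q ξ).2 j * w.2 j.castSucc =
      (b.inertia *ᵥ ξ) ⬝ᵥ η + b.m * ((b.rollVelocity q ξ).2 ⬝ᵥ w.2) := by
  rw [Matrix.vec3_dotProduct (b.rollVelocity q ξ).2, rollVelocity_snd_two, hw]
  simp only [momentum, LinearMap.coe_mk, AddHom.coe_mk, add_dotProduct, smul_dotProduct,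
    Fin.sum_univ_two, smul_eq_mul, dotProduct_comm (b.lever q)]
  simp
  ring

theorem momentum_pairing_rollVelocity {q : ConfAmb} (hq : q ∈ b.Q) (ξ η : Vec3) :
    (b.momentum q ξ).1 ⬝ᵥ η +
        ∑ j : Fin 2, (b.momentum q ξ).2 j * (b.rollVelocity q η).2 j.castSucc =
      b.rollMetric q ξ η := by
  rw [momentum_pairing ξ (rollVelocity_snd_two q η), rollVelocity_dotProduct hq, rollMetric]

theorem covector_momentum {q : ConfAmb} (hq : q ∈ b.Q) (ξ : Vec3) {w : ConfAmb}
    (hw : w ∈ tangentVectors b.Q q) :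
    covector (q, b.momentum q ξ) w = b.kineticMetric q (b.rollVelocity q ξ) w := by
  obtain ⟨η, h1, h2⟩ := (mem_tangentVectors_Q hq w).1 hw
  rw [covector_eq (x := (q, b.momentum q ξ)) hq h1, momentum_pairing ξ h2,
    kineticMetric_eq hq (rollVelocity_fst q ξ) h1]

theorem mem_constraintManifold {x : PhaseAmb} :
    x ∈ b.constraintManifold ↔ x.1 ∈ b.Q ∧ ∃ ξ, x.2 = b.momentum x.1 ξ := by
  constructor
  · rintro ⟨hq, v, hv, h⟩
    obtain ⟨ξ, rfl⟩ := (mem_D hq v).1 hv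
    refine ⟨hq, ξ, ?_⟩
    have key : ∀ (η : Vec3) (r : Fin 2 → ℝ),
        x.2.1 ⬝ᵥ η + ∑ j, x.2.2 j * r j =
          (b.momentum x.1 ξ).1 ⬝ᵥ η + ∑ j, (b.momentum x.1 ξ).2 j * r j := by
      intro η r
      -- Tangent vectors of `Q` have arbitrary `η`, `ȧ₁`, `ȧ₂`, enough to read off every component
      -- of a covector.
      let w : ConfAmb := (fun i => x.1.1 i ⨯₃ η, ![r 0, r 1, -(η ⬝ᵥ b.lever x.1)])
      have hw : w ∈ tangentVectors b.Q x.1 := (mem_tangentVectors_Q hq w).2 ⟨η, rfl, rfl⟩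
      have e := h w hw
      rw [← covector_momentum hq ξ hw, covector_eq hq (η := η) rfl,
        covector_eq (x := (x.1, b.momentum x.1 ξ)) hq (η := η) rfl] at e
      simpa [Fin.sum_univ_two, w] using e
    refine Prod.ext (funext fun i => ?_) (funext fun j => ?_)
    · simpa using key (Pi.single i 1) 0
    · simpa [Pi.single_apply] using key 0 (Pi.single j 1)
  · rintro ⟨hq, ξ, h⟩
    refine ⟨hq, _, (mem_D hq _).2 ⟨ξ, rfl⟩, fun w hw => ?_⟩
    rw [← covector_momentum hq ξ hw, ← h]

theorem velocity_momentum {q : ConfAmb} (hq : q ∈ b.Q) (ξ : Vec3) :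
    b.velocity (q, b.momentum q ξ) = b.rollVelocity q ξ := by
  have hex : ∃ v, v ∈ tangentVectors b.Q q ∧ ∀ w ∈ tangentVectors b.Q q,
      covector (q, b.momentum q ξ) w = b.kineticMetric q v w :=
    ⟨_, rollVelocity_mem_tangentVectors hq ξ, fun w hw => covector_momentum hq ξ hw⟩
  obtain ⟨hv, h⟩ := Classical.epsilon_spec hex
  change b.velocity (q, b.momentum q ξ) ∈ _ at hv
  change ∀ w ∈ tangentVectors b.Q q, _ = b.kineticMetric q (b.velocity (q, b.momentum q ξ)) w at h
  generalize b.velocity (q, b.momentum q ξ) = v at hv h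
  obtain ⟨η, h1, h2⟩ := (mem_tangentVectors_Q hq v).1 hv
  have d1 : (v - b.rollVelocity q ξ).1 = fun i => q.1 i ⨯₃ (η - ξ) := by
    ext1 i
    simp [h1, rollVelocity_fst]
  have hd : v - b.rollVelocity q ξ ∈ tangentVectors b.Q q := by
    refine (mem_tangentVectors_Q hq _).2 ⟨η - ξ, d1, ?_⟩
    rw [sub_dotProduct, Prod.snd_sub, Pi.sub_apply, h2, rollVelocity_snd_two]
    ring
  have e := h _ hd
  rw [covector_momentum hq ξ hd, kineticMetric_eq hq (rollVelocity_fst q ξ) d1,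
    kineticMetric_eq hq h1 d1] at e
  -- The chosen velocity and the rolling one represent the same covector, so their difference has
  -- zero kinetic energy.
  have e' : (b.inertia *ᵥ (η - ξ)) ⬝ᵥ (η - ξ) +
      b.m * ((v - b.rollVelocity q ξ).2 ⬝ᵥ (v - b.rollVelocity q ξ).2) = 0 := by
    nth_rewrite 1 [Prod.snd_sub]
    rw [Matrix.mulVec_sub, sub_dotProduct, sub_dotProduct]
    linarith
  have hn := mul_nonneg b.m_pos.le (dotProduct_self_nonneg' (v - b.rollVelocity q ξ).2)
  have hz := eq_zero_of_inertia (b := b) (ξ := η - ξ) (by linarith)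
  rw [hz, Matrix.mulVec_zero, zero_dotProduct, zero_add, mul_eq_zero,
    dotProduct_self_eq_zero] at e'
  refine sub_eq_zero.1 (Prod.ext ?_ (e'.resolve_left b.m_pos.ne'))
  rw [d1, hz]
  ext1 i
  simp

theorem Omega_momentum {q : ConfAmb} (hq : q ∈ b.Q) (ξ : Vec3) :
    b.Omega (q, b.momentum q ξ) = ξ := by
  rw [Omega, velocity_momentum hq]
  exact angVel_eq (Q.transpose_mul_self hq) (rollVelocity_fst q ξ)

theorem hamiltonian_momentum {q : ConfAmb} (hq : q ∈ b.Q) (ξ : Vec3) :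
    b.hamiltonian (q, b.momentum q ξ) = 1 / 2 * b.rollMetric q ξ ξ + b.m * b.grav * q.2 2 := by
  rw [hamiltonian, velocity_momentum hq,
    covector_momentum hq ξ (rollVelocity_mem_tangentVectors hq ξ), lagrangian,
    kineticMetric_rollVelocity hq]
  ring

theorem eq_momentum_Omega {x : PhaseAmb} (hx : x ∈ b.constraintManifold) :
    x = (x.1, b.momentum x.1 (b.Omega x)) := by
  obtain ⟨hq, ξ, h⟩ := mem_constraintManifold.1 hx
  have hx' : x = (x.1, b.momentum x.1 ξ) := Prod.ext rfl h
  have hO : b.Omega x = ξ := by rw [hx', Omega_momentum hq]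
  rw [hO]
  exact hx'

/-! ### Smoothness on the constraint submanifold -/

theorem contDiffOn_s_row (b : BodyOfRevolution) :
    ContDiffOn ℝ ∞ (fun q : ConfAmb => b.s (q.1 2)) b.Q :=
  b.contDiffOn_s.comp (by fun_prop) fun _ hq => Q.row_dotProduct hq

theorem contDiffOn_lever (b : BodyOfRevolution) : ContDiffOn ℝ ∞ b.lever b.Q :=
  b.contDiffOn_s_row.crossProduct_vec3 (by fun_prop)

variable (b) in
/-- The inverse of the inertia tensor. -/
def inertiaInv (v : Vec3) : Vec3 := ![v 0 / b.I₁, v 1 / b.I₁, v 2 / b.I₃]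

variable (b) in
/-- The angular velocity in terms of the momenta, by the Sherman-Morrison formula. -/
def angVelOfMomentum (x : PhaseAmb) : Vec3 :=
  b.inertiaInv x.2.1 - (b.m * (b.lever x.1 ⬝ᵥ b.inertiaInv x.2.1) /
    (1 + b.m * (b.lever x.1 ⬝ᵥ b.inertiaInv (b.lever x.1)))) • b.inertiaInv (b.lever x.1)

theorem one_add_lever_pos (b : BodyOfRevolution) (u : Vec3) :
    0 < 1 + b.m * (u ⬝ᵥ b.inertiaInv u) := by
  have : 0 ≤ u ⬝ᵥ b.inertiaInv u := by
    rw [Matrix.vec3_dotProduct]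
    simp only [inertiaInv, Matrix.cons_val, ← mul_div_assoc]
    have h1 := b.I₁_pos.le
    have h3 := b.I₃_pos.le
    exact add_nonneg (add_nonneg (div_nonneg (mul_self_nonneg _) h1)
      (div_nonneg (mul_self_nonneg _) h1)) (div_nonneg (mul_self_nonneg _) h3)
  have := mul_nonneg b.m_pos.le this
  linarith

theorem angVelOfMomentum_momentum (q : ConfAmb) (ξ : Vec3) :
    b.angVelOfMomentum (q, b.momentum q ξ) = ξ := by
  have h1 := b.I₁_pos.ne'
  have h3 := b.I₃_pos.ne'
  have hN : b.inertiaInv (b.momentum q ξ).1 =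
      ξ + (b.m * (ξ ⬝ᵥ b.lever q)) • b.inertiaInv (b.lever q) := by
    ext i
    fin_cases i <;>
      simp [inertiaInv, momentum, inertia_mulVec, Matrix.vecHead, Matrix.vecTail] <;> field_simp
  have hc := (b.one_add_lever_pos (b.lever q)).ne'
  rw [angVelOfMomentum]
  simp only [hN]
  rw [dotProduct_add, dotProduct_smul, dotProduct_comm _ ξ, smul_eq_mul]
  rw [show b.m * (ξ ⬝ᵥ b.lever q + b.m * (ξ ⬝ᵥ b.lever q) *
      (b.lever q ⬝ᵥ b.inertiaInv (b.lever q))) = b.m * (ξ ⬝ᵥ b.lever q) *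
      (1 + b.m * (b.lever q ⬝ᵥ b.inertiaInv (b.lever q))) by ring, mul_div_cancel_right₀ _ hc,
    add_sub_cancel_right]

theorem contDiff_inertiaInv (b : BodyOfRevolution) : ContDiff ℝ ∞ b.inertiaInv := by
  refine contDiff_pi.2 fun i => ?_
  fin_cases i <;> simp [inertiaInv] <;> fun_prop

/-- `Omega` is defined by choice; on `𝓜` it agrees with the explicit `angVelOfMomentum`, whose
denominator is positive. -/
theorem contDiffOn_Omega (b : BodyOfRevolution) :
    ContDiffOn ℝ ∞ b.Omega b.constraintManifold := by
  have hu : ContDiffOn ℝ ∞ (fun x : PhaseAmb => b.lever x.1) b.constraintManifold :=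
    b.contDiffOn_lever.comp (by fun_prop) fun _ hx => hx.1
  have hU := b.contDiff_inertiaInv.comp_contDiffOn hu
  have hN : ContDiffOn ℝ ∞ (fun x : PhaseAmb => b.inertiaInv x.2.1) b.constraintManifold :=
    b.contDiff_inertiaInv.comp_contDiffOn (by fun_prop)
  have h : ContDiffOn ℝ ∞ b.angVelOfMomentum b.constraintManifold :=
    hN.sub (((contDiffOn_const.mul (hu.dotProduct_vec3 hN)).div
      (contDiffOn_const.add (contDiffOn_const.mul (hu.dotProduct_vec3 hU)))
        fun x _ => (b.one_add_lever_pos (b.lever x.1)).ne').smul hU)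
  refine h.congr fun x hx => ?_
  nth_rewrite 2 [eq_momentum_Omega hx]
  rw [angVelOfMomentum_momentum]

theorem contDiff_inertia_mulVec (b : BodyOfRevolution) :
    ContDiff ℝ ∞ fun ξ : Vec3 => b.inertia *ᵥ ξ := by
  refine contDiff_pi.2 fun i => ?_
  simp only [inertia_mulVec]
  fin_cases i <;> simp <;> fun_prop

theorem contDiffOn_hamiltonian (b : BodyOfRevolution) :
    ContDiffOn ℝ ∞ b.hamiltonian b.constraintManifold := by
  have hO := b.contDiffOn_Omega
  have hs : ContDiffOn ℝ ∞ (fun x : PhaseAmb => b.s (x.1.1 2)) b.constraintManifold :=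
    b.contDiffOn_s_row.comp (f := fun x : PhaseAmb => x.1) (by fun_prop) fun _ hx => hx.1
  have hr := hO.crossProduct_vec3 hs
  have ha : ContDiffOn ℝ ∞ (fun x : PhaseAmb => x.1.2 2) b.constraintManifold := by fun_prop
  have h := (contDiffOn_const (c := (1 / 2 : ℝ))).mul
    (((b.contDiff_inertia_mulVec.comp_contDiffOn hO).dotProduct_vec3 hO).add
      ((contDiffOn_const (c := b.m)).mul (hr.dotProduct_vec3 hr))) |>.add
    ((contDiffOn_const (c := b.m * b.grav)).mul ha)
  refine h.congr fun x hx => ?_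
  nth_rewrite 1 [eq_momentum_Omega hx]
  rw [hamiltonian_momentum hx.1]
  rfl

theorem contDiffOn_momentum (b : BodyOfRevolution) :
    ContDiffOn ℝ ∞ (fun p : ConfAmb × Vec3 => b.momentum p.1 p.2) (b.Q ×ˢ Set.univ) := by
  have hm : Set.MapsTo (fun p : ConfAmb × Vec3 => p.1) (b.Q ×ˢ Set.univ) b.Q := fun _ h => h.1
  have hξ : ContDiffOn ℝ ∞ (fun p : ConfAmb × Vec3 => p.2) (b.Q ×ˢ Set.univ) := by fun_prop
  have hu : ContDiffOn ℝ ∞ (fun p : ConfAmb × Vec3 => b.lever p.1) (b.Q ×ˢ Set.univ) :=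
    b.contDiffOn_lever.comp (by fun_prop) hm
  have hs : ContDiffOn ℝ ∞ (fun p : ConfAmb × Vec3 => b.s (p.1.1 2)) (b.Q ×ˢ Set.univ) :=
    b.contDiffOn_s_row.comp (f := fun p : ConfAmb × Vec3 => p.1) (by fun_prop) hm
  refine ContDiffOn.prodMk ?_ (contDiffOn_pi.2 fun j => ?_)
  · exact (b.contDiff_inertia_mulVec.comp_contDiffOn hξ).add
      ((contDiffOn_const.mul (hξ.dotProduct_vec3 hu)).smul hu)
  · have hr : ContDiffOn ℝ ∞ (fun p : ConfAmb × Vec3 => p.1.1 j.castSucc)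
        (b.Q ×ˢ Set.univ) := by fun_prop
    exact contDiffOn_const.mul (hr.dotProduct_vec3 (hξ.crossProduct_vec3 hs)).neg

theorem contDiffOn_B (b : BodyOfRevolution) : ContDiffOn ℝ ∞ b.B b.constraintManifold := by
  have hγ : ContDiffOn ℝ ∞ (fun x : PhaseAmb => x.1.1 2) b.constraintManifold := by fun_prop
  have hs : ContDiffOn ℝ ∞ (fun x : PhaseAmb => b.s (x.1.1 2)) b.constraintManifold :=
    b.contDiffOn_s_row.comp (f := fun x : PhaseAmb => x.1) (by fun_prop) fun _ hx => hx.1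
  have hρ : ContDiffOn ℝ ∞ (fun x : PhaseAmb => b.ρ (x.1.1 2 2)) b.constraintManifold := by
    refine b.ρ_smooth.comp (f := fun x : PhaseAmb => x.1.1 2 2) (by fun_prop) fun x hx => ?_
    have h := Q.row_dotProduct hx.1
    rw [Matrix.vec3_dotProduct] at h
    constructor <;> nlinarith [mul_self_nonneg (x.1.1 2 0), mul_self_nonneg (x.1.1 2 1)]
  have hd : ∀ i x, dMaurerCartan i x = dMaurerCartan i 0 := fun i x => by
    ext v
    rw [show v = ![v 0, v 1] by ext1 j; fin_cases j <;> rfl, dMaurerCartan_apply,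
      dMaurerCartan_apply]
  refine ((contDiffOn_const.mul hρ).mul (hγ.dotProduct_vec3 hs)).smul
    (ContDiffOn.sum fun i _ => (contDiffOn_pi.1 b.contDiffOn_Omega i).smul
      ((contDiffOn_const (c := dMaurerCartan i 0)).congr fun x _ => hd i x))

end BodyOfRevolution

end

noncomputable section

namespace BodyOfRevolution

variable (b : BodyOfRevolution)

/-! ### Tangent vectors of the constraint submanifold -/

/-- The derivative of the momentum along the configuration space and the angular velocities. -/
def dMomentum (q : ConfAmb) (ξ : Vec3) : ConfAmb × Vec3 →L[ℝ] Vec3 × (Fin 2 → ℝ) :=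
  fderivWithin ℝ (fun p : ConfAmb × Vec3 => b.momentum p.1 p.2) (b.Q ×ˢ Set.univ) (q, ξ)

/-- The parametrization of the distribution `𝓒` by a body angular velocity and its variation. -/
def frameC (q : ConfAmb) (ξ : Vec3) : Vec3 × Vec3 →ₗ[ℝ] PhaseAmb :=
  ((b.rollVelocity q).comp (LinearMap.fst ℝ Vec3 Vec3)).prod
    ((b.dMomentum q ξ : ConfAmb × Vec3 →ₗ[ℝ] Vec3 × (Fin 2 → ℝ)).comp
      ((b.rollVelocity q).prodMap LinearMap.id))

variable {b}

/-- `Q × ℝ³` is not open in its ambient space, so only the values of `dMomentum` on velocities of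
curves in it carry meaning; the chain rule gives them. -/
theorem hasDerivAt_momentum {q : ConfAmb} {ξ : Vec3} {c : ℝ → ConfAmb} {Ω : ℝ → Vec3}
    {c' : ConfAmb} {Ω' : Vec3} (hc : HasDerivAt c c' 0) (hΩ : HasDerivAt Ω Ω' 0)
    (hcQ : ∀ᶠ t in 𝓝 0, c t ∈ b.Q) (hc0 : c 0 = q) (hΩ0 : Ω 0 = ξ) :
    HasDerivAt (fun t => b.momentum (c t) (Ω t)) (b.dMomentum q ξ (c', Ω')) 0 := by
  subst hc0 hΩ0
  have h := (b.contDiffOn_momentum.differentiableOn (by simp) (c 0, Ω 0)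
    ⟨hcQ.self_of_nhds, Set.mem_univ _⟩).hasFDerivWithinAt
  have hcQ' : ∀ᶠ t in 𝓝 (0 : ℝ), (c t, Ω t) ∈ b.Q ×ˢ (Set.univ : Set Vec3) :=
    hcQ.mono fun t ht => ⟨ht, Set.mem_univ _⟩
  exact h.comp_hasDerivAt (0 : ℝ) (hc.prodMk hΩ) hcQ'

theorem dMomentum_vertical {q : ConfAmb} (hq : q ∈ b.Q) (ξ η : Vec3) :
    b.dMomentum q ξ (0, η) = b.momentum q η := by
  have hΩ : HasDerivAt (fun t : ℝ => ξ + t • η) η 0 := by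
    simpa using ((hasDerivAt_id (0 : ℝ)).smul_const η).const_add ξ
  have h1 := hasDerivAt_momentum (b := b) (hasDerivAt_const (0 : ℝ) q) hΩ (.of_forall fun _ => hq)
    rfl (by simp : ξ + (0 : ℝ) • η = ξ)
  have h2 : HasDerivAt (fun t : ℝ => b.momentum q (ξ + t • η)) (b.momentum q η) 0 := by
    simp only [map_add, map_smul]
    simpa using ((hasDerivAt_id (0 : ℝ)).smul_const (b.momentum q η)).const_add (b.momentum q ξ)
  exact h1.unique h2

theorem mem_tangentVectors_constraintManifold {q : ConfAmb} (hq : q ∈ b.Q) (ξ : Vec3)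
    (v : PhaseAmb) :
    v ∈ tangentVectors b.constraintManifold (q, b.momentum q ξ) ↔
      v.1 ∈ tangentVectors b.Q q ∧ ∃ η, v.2 = b.dMomentum q ξ (v.1, η) := by
  constructor
  · rintro ⟨c, hc, hc0, hcM, hc'⟩
    have hcQ : ∀ᶠ t in 𝓝 0, (c t).1 ∈ b.Q := hcM.mono fun t ht => ht.1
    have hΩ := ((b.contDiffOn_Omega.comp_curve hc hcM).differentiableAt (by simp)).hasDerivAt
    refine ⟨⟨fun t => (c t).1, contDiffAt_fst.comp 0 hc, by simp [hc0], hcQ, hc'.fst⟩,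
      deriv (fun t => b.Omega (c t)) 0, ?_⟩
    have h := hasDerivAt_momentum hc'.fst hΩ hcQ (by rw [hc0])
      (by rw [hc0, Omega_momentum hq])
    have h2 : HasDerivAt (fun t => (c t).2) v.2 0 := hc'.snd
    exact h2.unique (h.congr_of_eventuallyEq (hcM.mono fun t ht =>
      congrArg Prod.snd (eq_momentum_Omega ht)))
  · rintro ⟨⟨c, hc, hc0, hcQ, hc'⟩, η, hη⟩
    have hΩ : HasDerivAt (fun t : ℝ => ξ + t • η) η 0 := by
      simpa using ((hasDerivAt_id (0 : ℝ)).smul_const η).const_add ξ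
    have hΩs : ContDiffAt ℝ ∞ (fun t : ℝ => ξ + t • η) 0 := by fun_prop
    have hM := hasDerivAt_momentum (ξ := ξ) hc' hΩ hcQ hc0 (by simp)
    refine ⟨fun t => (c t, b.momentum (c t) (ξ + t • η)), ?_, by simp [hc0],
      hcQ.mono fun t ht => mem_constraintManifold.2 ⟨ht, _, rfl⟩, ?_⟩
    · have hcQ' : ∀ᶠ t in 𝓝 (0 : ℝ), (c t, ξ + t • η) ∈ b.Q ×ˢ (Set.univ : Set Vec3) :=
        hcQ.mono fun t ht => ⟨ht, Set.mem_univ _⟩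
      have h := b.contDiffOn_momentum.comp_curve (c := fun t => (c t, ξ + t • η))
        (hc.prodMk hΩs) hcQ'
      exact hc.prodMk h
    · rw [← hη] at hM
      exact hc'.prodMk hM

/-- This exhibits `𝓒`, defined through velocities of curves, as a finite-dimensional linear
subspace, as `existsUnique_represents` requires. -/
theorem C_eq_range {q : ConfAmb} (hq : q ∈ b.Q) (ξ : Vec3) :
    b.C (q, b.momentum q ξ) = Set.range (b.frameC q ξ) := by
  ext v
  constructor
  · rintro ⟨hv, hD⟩
    obtain ⟨η, hη⟩ := ((mem_tangentVectors_constraintManifold hq ξ v).1 hv).2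
    obtain ⟨χ, hχ⟩ := (mem_D hq v.1).1 hD
    refine ⟨(χ, η), Prod.ext hχ.symm ?_⟩
    rw [hη, hχ]
    rfl
  · rintro ⟨⟨χ, η⟩, rfl⟩
    exact ⟨(mem_tangentVectors_constraintManifold hq ξ _).2
      ⟨rollVelocity_mem_tangentVectors hq χ, η, rfl⟩, (mem_D hq _).2 ⟨χ, rfl⟩⟩

theorem frameC_fst (q : ConfAmb) (ξ χ η : Vec3) :
    (b.frameC q ξ (χ, η)).1 = b.rollVelocity q χ := rfl

theorem frameC_vertical {q : ConfAmb} (hq : q ∈ b.Q) (ξ η : Vec3) :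
    b.frameC q ξ (0, η) = (0, b.momentum q η) := by
  refine Prod.ext ?_ ?_
  · rw [frameC_fst, map_zero]
  · change b.dMomentum q ξ (b.rollVelocity q 0, η) = _
    rw [map_zero, dMomentum_vertical hq]

/-! ### The 2-forms on the distribution -/

theorem maurerCartan_zero (i : Fin 3) (w : ConfAmb) : maurerCartan i 0 w = 0 :=
  (maurerCartanFlip i w).map_zero

/-- Against a vertical vector only the `dq ∧ dp` part survives: the vertical momentum is applied to
the base velocity. -/
theorem canonicalForm_vertical {x : PhaseAmb} (hq : x.1 ∈ b.Q) {v : PhaseAmb} {χ : Vec3}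
    (hv : v.1 = b.rollVelocity x.1 χ) (η : Vec3) :
    canonicalForm x ![v, (0, b.momentum x.1 η)] = b.rollMetric x.1 χ η := by
  have h : ∀ i, maurerCartan i x.1 v.1 = χ i :=
    congrFun (angVel_eq (Q.transpose_mul_self hq) (by rw [hv, rollVelocity_fst]))
  rw [hv] at h
  rw [canonicalForm_apply, rollMetric_comm, ← momentum_pairing_rollVelocity hq]
  simp [maurerCartan_zero, h, hv, daForm_apply, dotProduct]

theorem B_apply (x u v : PhaseAmb) :
    b.B x ![u, v] = (b.m * b.ρ (x.1.1 2 2) * (x.1.1 2 ⬝ᵥ b.s (x.1.1 2))) *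
      ∑ i, b.Omega x i * (maurerCartan i u.1 v.1 - maurerCartan i v.1 u.1) := by
  simp [B, dMaurerCartan_apply]

theorem B_vertical (x u : PhaseAmb) (p : Vec3 × (Fin 2 → ℝ)) : b.B x ![u, (0, p)] = 0 := by
  simp [B_apply, maurerCartan_zero]

theorem B_Omega {x : PhaseAmb} (hq : x.1 ∈ b.Q) {u v : PhaseAmb}
    (hu : u.1 = b.rollVelocity x.1 (b.Omega x)) (hv : v.1 ∈ tangentVectors b.Q x.1) :
    b.B x ![u, v] = 0 := by
  obtain ⟨η, h1, -⟩ := (mem_tangentVectors_Q hq v.1).1 hv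
  have h : ∀ i, maurerCartan i u.1 v.1 - maurerCartan i v.1 u.1 = -(b.Omega x ⨯₃ η) i :=
    maurerCartan_sub_swap (Q.transpose_mul_self hq) (by rw [hu, rollVelocity_fst]) h1
  have h0 := dot_self_cross (b.Omega x) η
  rw [dotProduct] at h0
  rw [B_apply]
  simp only [h, mul_neg, Finset.sum_neg_distrib, h0, neg_zero, mul_zero]

/-- A 2-form that agrees with the canonical one on vertical vectors is nondegenerate on `𝓒`. -/
theorem nondegenerateOn_C {q : ConfAmb} (hq : q ∈ b.Q) (ξ : Vec3)
    {σ : PhaseAmb [⋀^Fin 2]→L[ℝ] ℝ}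
    (hσ : ∀ χ η χ', σ ![b.frameC q ξ (χ, η), b.frameC q ξ (0, χ')] = b.rollMetric q χ χ') :
    NondegenerateOn (b.C (q, b.momentum q ξ)) σ := by
  rw [C_eq_range hq]
  rintro _ ⟨⟨χ, η⟩, rfl⟩ h
  -- Pairing with the vertical vector `(0, χ)` kills `χ`; the vector is then vertical, and pairing
  -- with `(η, 0)` kills `η`.
  have hχ : χ = 0 := eq_zero_of_rollMetric (b := b) (q := q) <| by
    rw [← hσ χ η χ]
    exact h _ ⟨_, rfl⟩
  subst hχ
  have hη : η = 0 := eq_zero_of_rollMetric (b := b) (q := q) <| by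
    rw [← hσ η 0 η]
    have hswap := σ.toAlternatingMap.map_swap ![b.frameC q ξ (0, η), b.frameC q ξ (η, 0)]
      (i := 0) (j := 1) (by decide)
    have e : ![b.frameC q ξ (0, η), b.frameC q ξ (η, 0)] ∘ Equiv.swap (0 : Fin 2) 1 =
        ![b.frameC q ξ (η, 0), b.frameC q ξ (0, η)] := by
      ext1 i
      fin_cases i <;> rfl
    rw [e] at hswap
    refine hswap.trans ?_
    rw [neg_eq_zero]
    exact h _ ⟨_, rfl⟩
  subst hη
  exact map_zero (b.frameC q ξ)

theorem canonicalForm_frameC {q : ConfAmb} (hq : q ∈ b.Q) (ξ χ η χ' : Vec3) :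
    canonicalForm (q, b.momentum q ξ) ![b.frameC q ξ (χ, η), b.frameC q ξ (0, χ')] =
      b.rollMetric q χ χ' := by
  rw [frameC_vertical hq]
  exact canonicalForm_vertical (x := (q, b.momentum q ξ)) hq rfl χ'

theorem canonicalForm_add_B_frameC {q : ConfAmb} (hq : q ∈ b.Q) (ξ χ η χ' : Vec3) :
    (canonicalForm (q, b.momentum q ξ) + b.B (q, b.momentum q ξ))
      ![b.frameC q ξ (χ, η), b.frameC q ξ (0, χ')] = b.rollMetric q χ χ' := by
  rw [ContinuousAlternatingMap.add_apply, canonicalForm_frameC hq, frameC_vertical hq, B_vertical,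
    add_zero]

/-! ### The hamiltonian along the fibres -/

theorem rollMetric_add_smul (q : ConfAmb) (ξ η : Vec3) (t : ℝ) :
    b.rollMetric q (ξ + t • η) (ξ + t • η) =
      b.rollMetric q ξ ξ + 2 * t * b.rollMetric q ξ η + t ^ 2 * b.rollMetric q η η := by
  have h := b.rollMetric_comm q η ξ
  simp only [rollMetric, Matrix.mulVec_add, Matrix.mulVec_smul, map_add, map_smul,
    LinearMap.add_apply, LinearMap.smul_apply, add_dotProduct, dotProduct_add, smul_dotProduct,
    dotProduct_smul, smul_eq_mul] at h ⊢
  linear_combination t * h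

/-- On a fibre of `𝓜` the hamiltonian is the quadratic form `½ rollMetric` plus a constant, and its
polarization is the derivative. -/
theorem dHamiltonian_vertical {q : ConfAmb} (hq : q ∈ b.Q) (ξ η : Vec3) :
    b.dHamiltonian (q, b.momentum q ξ) (b.frameC q ξ (0, η)) = b.rollMetric q ξ η := by
  have hx : (q, b.momentum q ξ) ∈ b.constraintManifold := mem_constraintManifold.2 ⟨hq, ξ, rfl⟩
  have hH := (b.contDiffOn_hamiltonian.differentiableOn (by simp) _ hx).hasFDerivWithinAt
  have hm : HasDerivAt (fun t : ℝ => b.momentum q (ξ + t • η)) (b.momentum q η) 0 := by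
    simp only [map_add, map_smul]
    simpa using ((hasDerivAt_id (0 : ℝ)).smul_const (b.momentum q η)).const_add (b.momentum q ξ)
  have h1 := hH.comp_hasDerivAt_of_eq (0 : ℝ) ((hasDerivAt_const (0 : ℝ) q).prodMk hm)
    (.of_forall fun t => mem_constraintManifold.2 ⟨hq, _, rfl⟩) (by simp)
  have h2 : HasDerivAt (fun t : ℝ => 1 / 2 * (b.rollMetric q ξ ξ + 2 * t * b.rollMetric q ξ η +
      t ^ 2 * b.rollMetric q η η) + b.m * b.grav * q.2 2) (b.rollMetric q ξ η) 0 := by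
    have := ((((((hasDerivAt_id (0 : ℝ)).const_mul 2).mul_const (b.rollMetric q ξ η)).const_add
      (b.rollMetric q ξ ξ)).add (((hasDerivAt_id (0 : ℝ)).pow 2).mul_const
        (b.rollMetric q η η))).const_mul (1 / 2)).add_const (b.m * b.grav * q.2 2)
    refine this.congr_deriv ?_
    simp
  rw [frameC_vertical hq]
  refine h1.unique (h2.congr_of_eventuallyEq (.of_forall fun t => ?_))
  simp only [Function.comp_apply]
  rw [hamiltonian_momentum hq, rollMetric_add_smul]

end BodyOfRevolution

end

theorem mainTheorem11 (b : BodyOfRevolution) :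
    -- the hamiltonian is smooth on the constraint submanifold, and the nonholonomic
    -- vector field is well defined
    ContDiffOn ℝ ∞ b.hamiltonian b.constraintManifold ∧
    (∀ x ∈ b.constraintManifold,
      ∃! X : PhaseAmb, Represents (b.C x) (canonicalForm x) (b.dHamiltonian x) X) ∧
    -- the two-form B is a dynamical gauge transformation
    b.IsDynamicalGaugeTransformation b.B ∧
    -- the bivector field of B is well defined and describes the nonholonomic dynamics
    (∀ x ∈ b.constraintManifold, ∀ α : PhaseAmb →L[ℝ] ℝ,
      ∃! X : PhaseAmb, Represents (b.C x) (canonicalForm x + b.B x) α X) ∧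
    (∀ x ∈ b.constraintManifold, b.Xnh x = -b.gaugeSharp b.B x (b.dHamiltonian x)) := by
  open BodyOfRevolution in
  have hB : ∀ x ∈ b.constraintManifold, NondegenerateOn (b.C x) (canonicalForm x + b.B x) :=
    fun x hx => by
      rw [eq_momentum_Omega hx]
      exact nondegenerateOn_C hx.1 _ fun _ _ _ => canonicalForm_add_B_frameC hx.1 _ _ _ _
  have hrange : ∀ x ∈ b.constraintManifold,
      b.C x = Set.range (b.frameC x.1 (b.Omega x)) := fun x hx => by
    nth_rewrite 1 [eq_momentum_Omega hx]
    exact C_eq_range hx.1 _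
  have hX : ∀ x ∈ b.constraintManifold,
      ∃! X : PhaseAmb, Represents (b.C x) (canonicalForm x) (b.dHamiltonian x) X := fun x hx => by
    refine existsUnique_represents _ (hrange x hx) _ ?_ _
    rw [eq_momentum_Omega hx]
    exact nondegenerateOn_C hx.1 _ fun _ _ _ => canonicalForm_frameC hx.1 _ _ _ _
  have hsharp : ∀ x ∈ b.constraintManifold, ∀ α : PhaseAmb →L[ℝ] ℝ,
      ∃! X : PhaseAmb, Represents (b.C x) (canonicalForm x + b.B x) α X := fun x hx α =>
    existsUnique_represents _ (hrange x hx) _ (hB x hx) α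
  have hnh : ∀ x ∈ b.constraintManifold,
      Represents (b.C x) (canonicalForm x) (b.dHamiltonian x) (b.Xnh x) := fun x hx =>
    Classical.epsilon_spec (hX x hx).exists
  -- The second-order condition: vertical test vectors give `rollMetric χ ψ = rollMetric Ω ψ` for
  -- all `ψ`, and `ψ = χ - Ω` yields `χ = Ω`.
  have hroll : ∀ x ∈ b.constraintManifold, (b.Xnh x).1 = b.rollVelocity x.1 (b.Omega x) := by
    intro x hx
    obtain ⟨hC, h⟩ := hnh x hx
    rw [hrange x hx] at hC
    obtain ⟨⟨χ, η⟩, hχ⟩ := hC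
    have key : ∀ ψ, b.rollMetric x.1 χ ψ = b.rollMetric x.1 (b.Omega x) ψ := fun ψ => by
      have e := h (b.frameC x.1 (b.Omega x) (0, ψ)) (by rw [hrange x hx]; exact ⟨_, rfl⟩)
      rw [← hχ] at e
      generalize hO : b.Omega x = ξ at e ⊢
      rw [eq_momentum_Omega hx, hO] at e
      rw [← canonicalForm_frameC hx.1 ξ χ η ψ, ← dHamiltonian_vertical hx.1]
      exact e
    have hsub : χ - b.Omega x = 0 := eq_zero_of_rollMetric (b := b) (q := x.1) <| by
      have e := key (χ - b.Omega x)
      rw [← sub_eq_zero] at e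
      rw [← e]
      simp only [rollMetric, Matrix.mulVec_sub, map_sub, LinearMap.sub_apply, sub_dotProduct]
      ring
    rw [← hχ, frameC_fst, sub_eq_zero.1 hsub]
  have hcontr : ∀ x ∈ b.constraintManifold, ∀ v ∈ tangentVectors b.constraintManifold x,
      b.B x ![b.Xnh x, v] = 0 := fun x hx v hv => by
    refine B_Omega hx.1 (hroll x hx) ?_
    rw [eq_momentum_Omega hx] at hv
    exact ((mem_tangentVectors_constraintManifold hx.1 _ v).1 hv).1
  refine ⟨b.contDiffOn_hamiltonian, hX, ⟨b.contDiffOn_B, hB, hcontr⟩, hsharp, fun x hx => ?_⟩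
  rw [gaugeSharp, neg_neg]
  -- As `i_{X_nh} B = 0`, the field `X_nh` also represents `dH` for `Ω_𝓜 + B`, where the solution is
  -- unique.
  refine (hsharp x hx (b.dHamiltonian x)).unique ⟨(hnh x hx).1, fun v hv => ?_⟩
    (Classical.epsilon_spec (hsharp x hx (b.dHamiltonian x)).exists)
  rw [ContinuousAlternatingMap.add_apply, hcontr x hx v hv.1, add_zero]
  exact (hnh x hx).2 v hv
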